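/- All graphs are finite undirected multigraphs without loops. A graph is *bispanning* if its edge set is the union of two disjoint spanning trees. A bispanning graph is *atomic* if its only bispanning subgraphs are itself and single-vertex graphs $K_1$. A graph is $k$-vertex-connected if it is connected, has more than $k$ vertices, and stays connected after deleting any fewer than $k$ vertices; $\operatorname{vconn}(G)$ is the greatest $k$ such that $G$ is $k$-vertex-connected. A set of vertices of $G$ is a vertex cut if deleting it increases the number of connected components. $G[W]$ is the subgraph of $G$ induced by a set $W$ of vertices, and $H+\{x,y\}$ is $H$ with one new edge joining its vertices $x$ and $y$. Given graphs $G_1,G_2$ with $k$-cliques $K_1\subseteq G_1$, $K_2\subseteq G_2$, a bijection $\sigma$ from the vertices of $K_1$ to those of $K_2$, and a set $E'$ of edges of $K_1$ and $K_2$, the *$k$-clique sum* of $G_1$ and $G_2$ is obtained from their disjoint union by contracting each pair $\{v,\sigma(v)\}$ to one vertex and then deleting all edges of $K_1$ and $K_2$ that are not in $E'$. **Theorem.** Let $G=(V,E)$ be an atomic bispanning graph with $\operatorname{vconn}(G)=2$ and let $\{x,y\}\subseteq V$ be a vertex cut of $G$. Then $G$ has no edge with ends $x$ and $y$. Moreover,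 there are proper subsets $V_1,V_2\subsetneq V$ with $V_1\cup V_2=V$ and $V_1\cap V_2=\{x,y\}$, such that every edge of $G$ lies in $G[V_1]$ or in $G[V_2]$, the graphs $G_1=G[V_1]+\{x,y\}$ and $G_2=G[V_2]+\{x,y\}$ are simple and bispanning, and $G$ is (up to isomorphism) the $2$-clique sum of $G_1$ and $G_2$ at the $2$-cliques formed by $x$, $y$ and the new edge in each of them, with $\sigma=\operatorname{id}_{\{x,y\}}$ and $E'=\emptyset$. -/

import Mathlib

open scoped Graph

/-! Throughout, graphs are multigraphs `G : Graph α β` with vertex set `V(G)`, edge set `E(G)` and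
incidence relation `G.IsLink e u v` ("the ends of `e` are `u` and `v`"). -/

namespace Graph

/-- `G` is connected: it has a vertex, and any two vertices are joined by a walk. -/
def Connected {α β : Type*} (G : Graph α β) : Prop :=
  V(G).Nonempty ∧ ∀ u ∈ V(G), ∀ v ∈ V(G), Relation.ReflTransGen G.Adj u v

/-- The vertices `v 0, …, v n` and the edges `e 0, …, e n`, all distinct, form a cycle of length
`n + 1`: the edge `e i` joins `v i` to `v (i + 1)`, indices being taken modulo `n + 1`. -/
def IsCycle {α β : Type*} (G : Graph α β) {n : ℕ} (v : Fin (n + 1) → α) (e : Fin (n + 1) → β) :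
    Prop :=
  Function.Injective v ∧ Function.Injective e ∧ ∀ i, G.IsLink (e i) (v i) (v (i + 1))

/-- `G` contains no cycle. -/
def Acyclic {α β : Type*} (G : Graph α β) : Prop :=
  ∀ (n : ℕ) (v : Fin (n + 1) → α) (e : Fin (n + 1) → β), ¬ G.IsCycle v e

/-- The edge set `T` is a spanning tree of `G`: the graph with all vertices of `G` and edge set `T`
is connected and acyclic. -/
def IsSpanningTree {α β : Type*} (G : Graph α β) (T : Set β) : Prop :=
  T ⊆ E(G) ∧ (G.restrict T).Connected ∧ (G.restrict T).Acyclic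

/-- `G` is bispanning: its edge set is the union of two disjoint spanning trees. -/
def Bispanning {α β : Type*} (G : Graph α β) : Prop :=
  ∃ S T : Set β, G.IsSpanningTree S ∧ G.IsSpanningTree T ∧ Disjoint S T ∧ S ∪ T = E(G)

/-- A bispanning graph is composite if it has a bispanning subgraph that is neither the graph
itself nor a single vertex `K₁`. -/
def CompositeBispanning {α β : Type*} (G : Graph α β) : Prop :=
  G.Bispanning ∧ ∃ H : Graph α β, H ≤ G ∧ H.Bispanning ∧ H ≠ G ∧ ¬ ∃ v, H = Graph.noEdge {v} β

/-- A bispanning graph is atomic if it is not composite. -/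
def AtomicBispanning {α β : Type*} (G : Graph α β) : Prop :=
  G.Bispanning ∧ ¬ G.CompositeBispanning

/-- The number of connected components of `G`, i.e. of maximal connected subgraphs. -/
noncomputable def comp {α β : Type*} (G : Graph α β) : ℕ∞ :=
  {C : Graph α β | Maximal (fun H : Graph α β => H ≤ G ∧ H.Connected) C}.encard

/-- A set of vertices is a vertex cut if deleting it increases the number of components. -/
def IsVertexCut {α β : Type*} (G : Graph α β) (X : Set α) : Prop :=
  X ⊆ V(G) ∧ G.comp < (G.deleteVerts X).comp

/-- `G` is `k`-vertex-connected: it is connected, has more than `k` vertices, and remains connected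
after deletion of any set of fewer than `k` vertices. -/
def VertexConnected {α β : Type*} (G : Graph α β) (k : ℕ) : Prop :=
  G.Connected ∧ (k : ℕ∞) < V(G).encard ∧
    ∀ X : Set α, X ⊆ V(G) → X.encard < k → (G.deleteVerts X).Connected

/-- The vertex-connectivity: the greatest `k` such that `G` is `k`-vertex-connected. -/
noncomputable def vconn {α β : Type*} (G : Graph α β) : ℕ :=
  sSup {k : ℕ | G.VertexConnected k}

/-- `G + {x, y}`: the graph `G` with one new edge, called `none`, added between its vertices `x` and
`y`. The old edges `e` are called `some e`. -/
def addNewEdge {α β : Type*} (G : Graph α β) (x y : α) : Graph α (Option β) where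
  vertexSet := V(G) ∪ {x, y}
  IsLink e u v := (e = none ∧ s(u, v) = s(x, y)) ∨ ∃ f, e = some f ∧ G.IsLink f u v
  isLink_symm := by
    refine fun e _ => ⟨fun u v h => ?_⟩
    rcases h with ⟨rfl, h⟩ | ⟨f, rfl, h⟩
    · exact Or.inl ⟨rfl, by rw [Sym2.eq_swap]; exact h⟩
    · exact Or.inr ⟨f, rfl, h.symm⟩
  eq_or_eq_of_isLink_of_isLink := by
    rintro e a b c d (⟨rfl, h⟩ | ⟨f, rfl, h⟩) (⟨h0, h'⟩ | ⟨g, hg, h'⟩)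
    · rcases Sym2.eq_iff.1 (h.trans h'.symm) with h | h
      · exact Or.inl h.1
      · exact Or.inr h.1
    · cases hg
    · cases h0
    · cases hg
      exact h.left_eq_or_eq h'
  left_mem_of_isLink := by
    rintro e a b (⟨rfl, h⟩ | ⟨f, rfl, h⟩)
    · rcases Sym2.eq_iff.1 h with h | h
      · exact Or.inr (Or.inl h.1)
      · exact Or.inr (Or.inr h.1)
    · exact Or.inl h.left_mem

/-- An isomorphism of graphs: bijections of the vertices and of the edges that respect the ends of
edges. -/
structure Iso {α β α' β' : Type*} (G : Graph α β) (H : Graph α' β') where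
  vertexEquiv : V(G) ≃ V(H)
  edgeEquiv : E(G) ≃ E(H)
  isLink_iff : ∀ (e : E(G)) (u v : V(G)),
    H.IsLink (edgeEquiv e : β') (vertexEquiv u : α') (vertexEquiv v : α') ↔ G.IsLink (e : β) u v

/-- The union of independent (disjoint) copies of `G₁` and `G₂`. -/
def disjointUnion {α₁ β₁ α₂ β₂ : Type*} (G₁ : Graph α₁ β₁) (G₂ : Graph α₂ β₂) :
    Graph (α₁ ⊕ α₂) (β₁ ⊕ β₂) where
  vertexSet := Sum.inl '' V(G₁) ∪ Sum.inr '' V(G₂)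
  IsLink e u v :=
    (∃ f a b, e = Sum.inl f ∧ u = Sum.inl a ∧ v = Sum.inl b ∧ G₁.IsLink f a b) ∨
    (∃ f a b, e = Sum.inr f ∧ u = Sum.inr a ∧ v = Sum.inr b ∧ G₂.IsLink f a b)
  isLink_symm := by
    refine fun e _ => ⟨fun u v h => ?_⟩
    rcases h with ⟨f, a, b, rfl, rfl, rfl, h⟩ | ⟨f, a, b, rfl, rfl, rfl, h⟩
    · exact Or.inl ⟨f, b, a, rfl, rfl, rfl, h.symm⟩
    · exact Or.inr ⟨f, b, a, rfl, rfl, rfl, h.symm⟩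
  eq_or_eq_of_isLink_of_isLink := by
    rintro e u v w z (⟨f, a, b, rfl, rfl, rfl, h⟩ | ⟨f, a, b, rfl, rfl, rfl, h⟩)
      (⟨f', a', b', hf, rfl, rfl, h'⟩ | ⟨f', a', b', hf, rfl, rfl, h'⟩) <;> cases hf
    · exact (h.left_eq_or_eq h').imp (congrArg _) (congrArg _)
    · exact (h.left_eq_or_eq h').imp (congrArg _) (congrArg _)
  left_mem_of_isLink := by
    rintro e u v (⟨f, a, b, rfl, rfl, rfl, h⟩ | ⟨f, a, b, rfl, rfl, rfl, h⟩)
    · exact Or.inl ⟨a, h.left_mem, rfl⟩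
    · exact Or.inr ⟨a, h.left_mem, rfl⟩

open Classical in
/-- Where a vertex goes when the pairwise disjoint vertex sets in `P` are contracted: a vertex in no
member of `P` stays itself, as `Sum.inl v`; a vertex in the member `X` becomes the new vertex
`Sum.inr X` (by disjointness `X` is the union of the members containing `v`). -/
noncomputable def contractVertex {α : Type*} (P : Set (Set α)) (v : α) : α ⊕ Set α :=
  if ∃ X ∈ P, v ∈ X then Sum.inr (⋃₀ {X ∈ P | v ∈ X}) else Sum.inl v

/-- `G / P`: contraction of each of the pairwise disjoint vertex sets in `P` to a new vertex. Edges
with both ends in the same member of `P` are removed. -/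
noncomputable def contract {α β : Type*} (G : Graph α β) (P : Set (Set α)) :
    Graph (α ⊕ Set α) β :=
  (G.map (contractVertex P)).deleteEdges {e | ∃ X ∈ P, ∀ v, G.Inc e v → v ∈ X}

/-- `K` is a `k`-clique of `G`: a subgraph of `G` that is a complete (simple) graph on `k`
vertices. -/
def IsKClique {α β : Type*} (G : Graph α β) (k : ℕ) (K : Graph α β) : Prop :=
  K ≤ G ∧ K.Simple ∧ V(K).encard = k ∧ ∀ u ∈ V(K), ∀ v ∈ V(K), u ≠ v → K.Adj u v

/-- The clique sum of `G₁` and `G₂` at the cliques `K₁` and `K₂`: in the disjoint union, identify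
each vertex `v` of `K₁` with `σ v`, then delete all edges of the two cliques except those in
the set `R` of remaining edges. -/
noncomputable def cliqueSum {α₁ β₁ α₂ β₂ : Type*} (G₁ : Graph α₁ β₁) (G₂ : Graph α₂ β₂)
    (K₁ : Graph α₁ β₁) (K₂ : Graph α₂ β₂) (σ : V(K₁) ≃ V(K₂)) (R : Set (β₁ ⊕ β₂)) :
    Graph ((α₁ ⊕ α₂) ⊕ Set (α₁ ⊕ α₂)) (β₁ ⊕ β₂) :=
  ((G₁.disjointUnion G₂).contract
    {X | ∃ v : V(K₁), X = {Sum.inl (v : α₁), Sum.inr (σ v : α₂)}}).deleteEdges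
      ((Sum.inl '' E(K₁) ∪ Sum.inr '' E(K₂)) \ R)

/-- `G` is (isomorphic to) the `k`-clique sum of `G₁` and `G₂` at the `k`-cliques `K₁` and `K₂` with
the vertex bijection `σ` and the remaining edges `R`. -/
def IsCliqueSum {α β α₁ β₁ α₂ β₂ : Type*} (k : ℕ) (G : Graph α β)
    (G₁ : Graph α₁ β₁) (G₂ : Graph α₂ β₂) (K₁ : Graph α₁ β₁) (K₂ : Graph α₂ β₂)
    (σ : V(K₁) ≃ V(K₂)) (R : Set (β₁ ⊕ β₂)) : Prop :=
  G₁.IsKClique k K₁ ∧ G₂.IsKClique k K₂ ∧ R ⊆ Sum.inl '' E(K₁) ∪ Sum.inr '' E(K₂) ∧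
    Nonempty (G.Iso (cliqueSum G₁ G₂ K₁ K₂ σ R))

end Graph

namespace Graph

open Relation

variable {α β : Type*} {G H H₁ H₂ : Graph α β} {F F' S T : Set β} {u v w x y a b : α} {e f : β}
  {V₁ V₂ W X : Set α}


/-! Let `S` and `T` be the two trees and let (V₁, V₂) be a separation with V₁ ∩ V₂ = {x, y}. A walk
can change sides only at x or y, so each tree joins x to y within V₁ or within V₂
(`reach_left_or_reach_right`). A tree that does so within V₁ restricts to a spanning tree of G[V₁]
(`isSpanningTree_left`); if both did, G[V₁] would be a proper bispanning subgraph, against atomicity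
(`not_reach_left_of_atomic`). Hence one tree joins x to y only in V₁ and the other only in V₂. On
each side one tree restricts to a spanning tree and the other to a forest of two components that
separate x from y, and the new edge links these (`bispanning_addNewEdge`).

An edge xy would lie in both sides, so its tree would join x to y in both, which the other tree
excludes (`not_isLink`). Hence every edge lies in exactly one side, and regluing at x and y gives G
back (`nonempty_iso_twoSum`). -/

/-! ### Walks within an edge set, and acyclicity. -/

/-- `u` and `v` are joined by a walk of `G` all of whose edges lie in `F`. -/
def Reach (G : Graph α β) (F : Set β) (u v : α) : Prop :=
  ReflTransGen (G.restrict F).Adj u v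

lemma Reach.refl (G : Graph α β) (F : Set β) (u : α) : G.Reach F u u := ReflTransGen.refl

lemma Reach.trans (h : G.Reach F u v) (h' : G.Reach F v w) : G.Reach F u w :=
  ReflTransGen.trans h h'

lemma Reach.symm (h : G.Reach F u v) : G.Reach F v u :=
  ReflTransGen.stdSymm.symm _ _ h

lemma Reach.mono (h : G.Reach F u v) (hF : F ⊆ F') : G.Reach F' u v :=
  ReflTransGen.mono (fun _ _ h => h.mono (G.restrict_mono_right hF)) _ _ h

lemma IsLink.reach (h : G.IsLink e u v) (he : e ∈ F) : G.Reach F u v :=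
  ReflTransGen.single ⟨e, he, h⟩

/-- A walk using possibly the edge `e` between `a` and `b` either avoids it or can be cut at its
ends. -/
lemma Reach.cut (he : G.IsLink e a b) (h : G.Reach F u v) :
    G.Reach (F \ {e}) u v ∨ (G.Reach (F \ {e}) u a ∧ G.Reach (F \ {e}) b v) ∨
      (G.Reach (F \ {e}) u b ∧ G.Reach (F \ {e}) a v) := by
  induction h with
  | refl => exact Or.inl (Reach.refl ..)
  | @tail c d _ hcd ih =>
    obtain ⟨f, hf, hcd⟩ := hcd
    by_cases hfe : f = e
    · subst hfe
      have ha := Reach.refl G (F \ {f}) a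
      have hb := Reach.refl G (F \ {f}) b
      rcases hcd.eq_and_eq_or_eq_and_eq he with ⟨rfl, rfl⟩ | ⟨rfl, rfl⟩ <;> tauto
    · have h : G.Reach (F \ {e}) c d := hcd.reach ⟨hf, hfe⟩
      rcases ih with h1 | ⟨h1, h2⟩ | ⟨h1, h2⟩
      · exact Or.inl (h1.trans h)
      · exact Or.inr (Or.inl ⟨h1, h2.trans h⟩)
      · exact Or.inr (Or.inr ⟨h1, h2.trans h⟩)

/-- A shortest walk repeats no vertex. Values of `p` beyond `n` are irrelevant. -/
lemma exists_injOn_walk {R : α → α → Prop} (h : ReflTransGen R u v) :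
    ∃ (n : ℕ) (p : ℕ → α), p 0 = u ∧ p n = v ∧ (∀ i < n, R (p i) (p (i + 1))) ∧
      Set.InjOn p (Set.Iic n) := by
  classical
  have hex : ∃ n, ∃ p : ℕ → α, p 0 = u ∧ p n = v ∧ ∀ i < n, R (p i) (p (i + 1)) := by
    induction h with
    | refl => exact ⟨0, fun _ => u, rfl, rfl, by simp⟩
    | @tail c d _ hcd ih =>
      obtain ⟨n, p, h0, hn, hp⟩ := ih
      refine ⟨n + 1, fun i => if i ≤ n then p i else d, by simpa, by simp, fun i hi => ?_⟩
      rcases Nat.lt_succ_iff_lt_or_eq.1 hi with hi | rfl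
      · simpa [hi.le, Nat.succ_le_of_lt hi] using hp i hi
      · simpa [hn] using hcd
  obtain ⟨p, h0, hn, hp⟩ := Nat.find_spec hex
  refine ⟨_, p, h0, hn, hp, ?_⟩
  set n := Nat.find hex
  have key : ∀ i j, i < j → j ≤ n → p i ≠ p j := by
    intro i j hij hjn hpij
    -- Cutting out the closed stretch from step `i` to step `j` gives a shorter walk.
    refine Nat.find_min hex (m := n - (j - i)) (by omega)
      ⟨fun k => if k ≤ i then p k else p (k + (j - i)), by simpa, ?_, fun k hk => ?_⟩
    · by_cases h : n - (j - i) ≤ i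
      · have : n = j := by omega
        have h2 : n - (j - i) = i := by omega
        simp only [h, if_true]
        rw [h2, hpij, ← this, hn]
      · simp only [h, if_false]
        rw [Nat.sub_add_cancel (by omega), hn]
    · rcases lt_trichotomy k i with h | rfl | h
      · simpa [h.le, Nat.succ_le_of_lt h] using hp k (by omega)
      · have := hp j (by omega)
        simp only [le_refl, if_true, Nat.not_succ_le_self, if_false, hpij]
        rwa [show k + 1 + (j - k) = j + 1 by omega]
      · have := hp (k + (j - i)) (by omega)
        simp only [not_le.2 h, if_false, show ¬ k + 1 ≤ i by omega]
        rwa [show k + 1 + (j - i) = k + (j - i) + 1 by omega]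
  intro i hi j hj hij
  by_contra hne
  rcases lt_or_gt_of_ne hne with h | h
  · exact key i j h hj hij
  · exact key j i h hi hij.symm

/-- A shortest walk avoiding `e`, closed up by `e`, would be a cycle. With the converse below, this
lets acyclicity be handled without cycles. -/
lemma Acyclic.not_reach (hF : (G.restrict F).Acyclic) (he : e ∈ F) (h : G.IsLink e u v) :
    ¬ G.Reach (F \ {e}) u v := by
  intro hr
  obtain ⟨n, p, h0, hn, hp, hinj⟩ := exists_injOn_walk hr
  have : Nonempty β := ⟨e⟩
  choose! f hf using hp
  have hfl : ∀ i < n, f i ∈ F ∧ f i ≠ e ∧ G.IsLink (f i) (p i) (p (i + 1)) :=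
    fun i hi => ⟨(hf i hi).1.1, (hf i hi).1.2, (hf i hi).2⟩
  have hpi : ∀ {i j : ℕ}, i ≤ n → j ≤ n → p i = p j → i = j := fun hi hj h => hinj hi hj h
  -- The last index carries `e`, leading from `p n = v` back to `p 0 = u`; for `n = 0` the cycle is
  -- a loop.
  refine hF n (fun i => p i) (fun i => if (i : ℕ) < n then f i else e) ⟨?_, ?_, ?_⟩
  · intro i j hij
    exact Fin.ext (hpi (Nat.le_of_lt_succ i.2) (Nat.le_of_lt_succ j.2) hij)
  · intro i j hij
    have hi := i.2
    have hj := j.2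
    apply Fin.ext
    by_cases h1 : (i : ℕ) < n <;> by_cases h2 : (j : ℕ) < n <;> simp only [h1, h2, if_true,
      if_false] at hij
    · have hl := (hfl i h1).2.2
      rw [hij] at hl
      rcases hl.eq_and_eq_or_eq_and_eq (hfl j h2).2.2 with ⟨h, -⟩ | ⟨h, h'⟩
      · exact hpi h1.le h2.le h
      · have h := hpi h1.le h2 h
        have h' := hpi h1 h2.le h'
        omega
    · exact absurd hij (hfl i h1).2.1
    · exact absurd hij.symm (hfl j h2).2.1
    · omega
  · intro i
    have hi := i.2
    by_cases h1 : (i : ℕ) < n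
    · have : ((i + 1 : Fin (n + 1)) : ℕ) = i + 1 :=
        Fin.val_add_one_of_lt (by rw [Fin.lt_def]; simpa using h1)
      simp only [h1, if_true, this]
      exact ⟨(hfl i h1).1, (hfl i h1).2.2⟩
    · have hi : i = Fin.last n := by apply Fin.ext; simp; omega
      subst hi
      simp only [Fin.val_last, lt_irrefl, if_false, Fin.last_add_one, Fin.val_zero, h0, hn]
      exact ⟨he, h.symm⟩

/-- The other edges of a cycle join the ends of its last edge. -/
lemma acyclic_of_forall_not_reach
    (h : ∀ e ∈ F, ∀ u v, G.IsLink e u v → ¬ G.Reach (F \ {e}) u v) : (G.restrict F).Acyclic := by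
  rintro n p f ⟨-, hf, hl⟩
  have key : ∀ i : Fin (n + 1), G.Reach (F \ {f (Fin.last n)}) (p 0) (p i) := by
    intro i
    induction i using Fin.induction with
    | zero => exact Reach.refl ..
    | succ i ih =>
      have h1 := hl i.castSucc
      rw [Fin.coeSucc_eq_succ] at h1
      refine ih.trans (h1.2.reach ⟨h1.1, fun h => ?_⟩)
      exact (Fin.castSucc_lt_last i).ne (hf h)
  have h1 := hl (Fin.last n)
  rw [Fin.last_add_one] at h1
  exact h _ h1.1 _ _ h1.2 (key _).symm

lemma Acyclic.mono (hF : (G.restrict F).Acyclic) (h : F' ⊆ F) : (G.restrict F').Acyclic :=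
  fun n p f hc => hF n p f ⟨hc.1, hc.2.1, fun i => (hc.2.2 i).mono (G.restrict_mono_right h)⟩

lemma isSpanningTree_iff {T : Set β} : G.IsSpanningTree T ↔
    T ⊆ E(G) ∧ V(G).Nonempty ∧ (∀ u ∈ V(G), ∀ v ∈ V(G), G.Reach T u v) ∧
      (G.restrict T).Acyclic := by
  simp only [IsSpanningTree, Connected, vertexSet_restrict, and_assoc]; rfl


/-! ### Passing to subgraphs. -/

/-- Lets walks of `G.induce V₁` be studied in `G`, as walks with edges in `E(G.induce V₁)`. -/
lemma reach_iff_of_le (hle : H ≤ G) (hF : F ⊆ E(H)) : H.Reach F u v ↔ G.Reach F u v := by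
  refine ⟨fun h => ReflTransGen.mono ?_ _ _ h, fun h => ReflTransGen.mono ?_ _ _ h⟩
  · rintro a b ⟨e, he, h⟩
    exact ⟨e, he, h.mono hle⟩
  · rintro a b ⟨e, he, h⟩
    exact ⟨e, he, (hle.isLink_iff (hF he)).2 h⟩

lemma Acyclic.of_le (hF : (G.restrict F).Acyclic) (hle : H ≤ G) : (H.restrict F).Acyclic :=
  fun n p f hc => hF n p f ⟨hc.1, hc.2.1, fun i => (hc.2.2 i).mono (restrict_mono_left hle F)⟩

lemma IsLink.mem_edgeSet_induce_iff (h : G.IsLink e u v) :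
    e ∈ E(G.induce W) ↔ u ∈ W ∧ v ∈ W := by
  rw [edgeSet_induce]
  refine ⟨?_, fun hW => ⟨u, v, h, hW⟩⟩
  rintro ⟨a, b, hab, ha, hb⟩
  rcases h.eq_and_eq_or_eq_and_eq hab with ⟨rfl, rfl⟩ | ⟨rfl, rfl⟩
  · exact ⟨ha, hb⟩
  · exact ⟨hb, ha⟩

/-! ### Adding an edge -/

lemma addNewEdge_isLink_none : (H.addNewEdge x y).IsLink none u v ↔ s(u, v) = s(x, y) := by
  simp [addNewEdge]

lemma addNewEdge_isLink_some :
    (H.addNewEdge x y).IsLink (some e) u v ↔ H.IsLink e u v := by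
  simp [addNewEdge]

lemma vertexSet_addNewEdge (hx : x ∈ V(H)) (hy : y ∈ V(H)) : V(H.addNewEdge x y) = V(H) := by
  refine Set.union_eq_left.2 ?_
  rintro z (rfl | rfl) <;> assumption

lemma none_mem_edgeSet_addNewEdge : none ∈ E(H.addNewEdge x y) :=
  (addNewEdge_isLink_none.2 rfl).edge_mem

lemma some_mem_edgeSet_addNewEdge : some e ∈ E(H.addNewEdge x y) ↔ e ∈ E(H) := by
  simp only [edge_mem_iff_exists_isLink, addNewEdge_isLink_some]

lemma edgeSet_addNewEdge : E(H.addNewEdge x y) = insert none (some '' E(H)) := by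
  ext (_ | e)
  · simp [none_mem_edgeSet_addNewEdge]
  · simp [some_mem_edgeSet_addNewEdge]

lemma reach_addNewEdge_image :
    (H.addNewEdge x y).Reach (some '' F) u v ↔ H.Reach F u v := by
  refine ⟨fun h => ReflTransGen.mono ?_ _ _ h, fun h => ReflTransGen.mono ?_ _ _ h⟩
  · rintro a b ⟨_, ⟨e, he, rfl⟩, h⟩
    exact ⟨e, he, addNewEdge_isLink_some.1 h⟩
  · rintro a b ⟨e, he, h⟩
    exact ⟨some e, ⟨e, he, rfl⟩, addNewEdge_isLink_some.2 h⟩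

lemma Acyclic.addNewEdge_image (hF : (H.restrict F).Acyclic) :
    ((H.addNewEdge x y).restrict (some '' F)).Acyclic := by
  refine acyclic_of_forall_not_reach ?_
  rintro _ ⟨e, he, rfl⟩ u v hl hr
  refine hF.not_reach he (addNewEdge_isLink_some.1 hl) (reach_addNewEdge_image.1 (hr.mono ?_))
  rintro _ ⟨⟨f, hf, rfl⟩, hfe⟩
  exact ⟨f, ⟨hf, fun h => hfe (congrArg some h)⟩, rfl⟩

lemma Acyclic.addNewEdge_insert (hF : (H.restrict F).Acyclic) (hxy : ¬ H.Reach F x y) :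
    ((H.addNewEdge x y).restrict (insert none (some '' F))).Acyclic := by
  have hnone : insert none (some '' F) \ {none} = some '' F := by
    ext (_ | e) <;> simp
  refine acyclic_of_forall_not_reach ?_
  rintro _ (rfl | ⟨e, he, rfl⟩) u v hl hr
  · rw [hnone, reach_addNewEdge_image] at hr
    rcases Sym2.eq_iff.1 (addNewEdge_isLink_none.1 hl) with ⟨rfl, rfl⟩ | ⟨rfl, rfl⟩
    · exact hxy hr
    · exact hxy hr.symm
  · have hsub : (insert none (some '' F) \ {some e}) \ {none} ⊆ some '' (F \ {e}) := by
      rintro (_ | f) hf <;> simp_all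
    have hl := addNewEdge_isLink_some.1 hl
    have hred : ∀ {a b}, (H.addNewEdge x y).Reach
        ((insert none (some '' F) \ {some e}) \ {none}) a b → H.Reach (F \ {e}) a b :=
      fun h => reach_addNewEdge_image.1 (h.mono hsub)
    have huv : H.Reach F u v := hl.reach he
    -- A walk from `u` to `v` without `e` that uses the new edge splits into two pieces in `F`;
    -- joined by `e`, they connect `x` to `y` in `F`.
    rcases hr.cut (addNewEdge_isLink_none.2 (rfl : s(x, y) = s(x, y))) with h | ⟨h1, h2⟩ | ⟨h1, h2⟩
    · exact hF.not_reach he hl (hred h)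
    · exact hxy (((hred h1).symm.mono Set.sdiff_subset).trans
        (huv.trans ((hred h2).symm.mono Set.sdiff_subset)))
    · exact hxy (((hred h2).mono Set.sdiff_subset).trans
        (huv.symm.trans ((hred h1).mono Set.sdiff_subset)))

/-- `hTc` and `hxy` say that the forest `T` has two components, one containing `x` and one `y`; the
new edge completes it to a tree. -/
lemma bispanning_addNewEdge (hx : x ∈ V(H)) (hy : y ∈ V(H)) (hS : H.IsSpanningTree S)
    (hTE : T ⊆ E(H)) (hT : (H.restrict T).Acyclic)
    (hTc : ∀ v ∈ V(H), H.Reach T v x ∨ H.Reach T v y) (hxy : ¬ H.Reach T x y)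
    (hdisj : Disjoint S T) (hunion : S ∪ T = E(H)) : (H.addNewEdge x y).Bispanning := by
  obtain ⟨hSE, -, hSc, hSa⟩ := isSpanningTree_iff.1 hS
  refine ⟨some '' S, insert none (some '' T), isSpanningTree_iff.2 ⟨?_, ?_, ?_, ?_⟩,
    isSpanningTree_iff.2 ⟨?_, ?_, ?_, ?_⟩, ?_, ?_⟩
  · rw [edgeSet_addNewEdge]
    exact (Set.image_mono hSE).trans (Set.subset_insert ..)
  · exact ⟨x, by rwa [vertexSet_addNewEdge hx hy]⟩
  · rw [vertexSet_addNewEdge hx hy]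
    exact fun u hu v hv => reach_addNewEdge_image.2 (hSc u hu v hv)
  · exact hSa.addNewEdge_image
  · rw [edgeSet_addNewEdge]
    exact Set.insert_subset_insert (Set.image_mono hTE)
  · exact ⟨x, by rwa [vertexSet_addNewEdge hx hy]⟩
  · rw [vertexSet_addNewEdge hx hy]
    have hyx : (H.addNewEdge x y).Reach (insert none (some '' T)) y x :=
      (addNewEdge_isLink_none.2 Sym2.eq_swap).reach (Set.mem_insert ..)
    have key : ∀ v ∈ V(H), (H.addNewEdge x y).Reach (insert none (some '' T)) v x := by
      intro v hv
      rcases hTc v hv with h | h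
      · exact (reach_addNewEdge_image.2 h).mono (Set.subset_insert ..)
      · exact ((reach_addNewEdge_image.2 h).mono (Set.subset_insert ..)).trans hyx
    exact fun u hu v hv => (key u hu).trans (key v hv).symm
  · exact hT.addNewEdge_insert hxy
  · rw [Set.disjoint_insert_right]
    exact ⟨by simp, (Set.disjoint_image_iff (Option.some_injective _)).2 hdisj⟩
  · rw [edgeSet_addNewEdge, Set.union_insert, ← Set.image_union, hunion]

lemma Simple.addNewEdge (hH : H.Simple) (hne : x ≠ y) (hxy : ¬ ∃ e, H.IsLink e x y) :
    (H.addNewEdge x y).Simple := by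
  have hnot : ∀ {e u v}, s(u, v) = s(x, y) → ¬ H.IsLink e u v := by
    intro e u v h hl
    rcases Sym2.eq_iff.1 h with ⟨rfl, rfl⟩ | ⟨rfl, rfl⟩
    · exact hxy ⟨e, hl⟩
    · exact hxy ⟨e, hl.symm⟩
  refine { not_isLoopAt := ?_, eq_of_isLink := ?_ }
  · rintro (_ | e) v h
    · rcases Sym2.eq_iff.1 (addNewEdge_isLink_none.1 h) with ⟨h1, h2⟩ | ⟨h1, h2⟩
      · exact hne (h1.symm.trans h2)
      · exact hne (h2.symm.trans h1)
    · exact hH.not_isLoopAt e v (addNewEdge_isLink_some.1 h)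
  · rintro (_ | e) (_ | f) u v h h'
    · rfl
    · exact absurd (addNewEdge_isLink_some.1 h') (hnot (addNewEdge_isLink_none.1 h))
    · exact absurd (addNewEdge_isLink_some.1 h) (hnot (addNewEdge_isLink_none.1 h'))
    · exact congrArg some (hH.eq_of_isLink (addNewEdge_isLink_some.1 h)
        (addNewEdge_isLink_some.1 h'))

/-! ### Separations of order two -/

/-- `V₁` and `V₂` cover the vertices and edges of `G` and meet in `{x, y}`. -/
structure IsTwoSeparation (G : Graph α β) (x y : α) (V₁ V₂ : Set α) : Prop where
  union_eq : V₁ ∪ V₂ = V(G)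
  inter_eq : V₁ ∩ V₂ = {x, y}
  mem_or_mem : ∀ ⦃e u v⦄, G.IsLink e u v → (u ∈ V₁ ∧ v ∈ V₁) ∨ (u ∈ V₂ ∧ v ∈ V₂)

namespace IsTwoSeparation

lemma symm (h : G.IsTwoSeparation x y V₁ V₂) : G.IsTwoSeparation x y V₂ V₁ :=
  ⟨by rw [Set.union_comm, h.union_eq], by rw [Set.inter_comm, h.inter_eq],
    fun _ _ _ hl => (h.mem_or_mem hl).symm⟩

lemma subset_left (h : G.IsTwoSeparation x y V₁ V₂) : V₁ ⊆ V(G) :=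
  h.union_eq ▸ Set.subset_union_left

lemma mem_left (h : G.IsTwoSeparation x y V₁ V₂) : x ∈ V₁ ∧ y ∈ V₁ := by
  have : {x, y} ⊆ V₁ := h.inter_eq ▸ Set.inter_subset_left
  exact ⟨this (by simp), this (by simp)⟩

lemma eq_or_eq (h : G.IsTwoSeparation x y V₁ V₂) (h1 : v ∈ V₁) (h2 : v ∈ V₂) :
    v = x ∨ v = y := by
  have : v ∈ V₁ ∩ V₂ := ⟨h1, h2⟩
  rwa [h.inter_eq] at this

lemma edgeSet_eq (h : G.IsTwoSeparation x y V₁ V₂) :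
    E(G) = E(G.induce V₁) ∪ E(G.induce V₂) := by
  ext e
  refine ⟨fun he => ?_, ?_⟩
  · obtain ⟨u, v, hl⟩ := G.exists_isLink_of_mem_edgeSet he
    exact (h.mem_or_mem hl).imp hl.mem_edgeSet_induce_iff.2 hl.mem_edgeSet_induce_iff.2
  · rintro (⟨_, _, hl, -⟩ | ⟨_, _, hl, -⟩) <;> exact hl.edge_mem

/-- Follow the walk until it first uses an edge outside `V₁`; it is then at `x` or `y`. -/
lemma reach_left_or (h : G.IsTwoSeparation x y V₁ V₂) (hr : G.Reach F v x) (hv : v ∈ V₁) :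
    G.Reach (F ∩ E(G.induce V₁)) v x ∨ G.Reach (F ∩ E(G.induce V₁)) v y := by
  induction hr using ReflTransGen.head_induction_on with
  | refl => exact Or.inl (Reach.refl ..)
  | @head v w hvw _ ih =>
    obtain ⟨e, he, hl⟩ := hvw
    rcases h.mem_or_mem hl with ⟨hv', hw⟩ | ⟨hv', hw⟩
    · have : G.Reach (F ∩ E(G.induce V₁)) v w :=
        hl.reach ⟨he, hl.mem_edgeSet_induce_iff.2 ⟨hv', hw⟩⟩
      exact (ih hw).imp this.trans this.trans
    · rcases h.eq_or_eq hv hv' with rfl | rfl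
      · exact Or.inl (Reach.refl ..)
      · exact Or.inr (Reach.refl ..)

lemma reach_left_or_reach_right (h : G.IsTwoSeparation x y V₁ V₂) (hr : G.Reach F x y) :
    G.Reach (F ∩ E(G.induce V₁)) x y ∨ G.Reach (F ∩ E(G.induce V₂)) x y := by
  by_contra! hn
  obtain ⟨hn1, hn2⟩ := hn
  -- If neither side joins `x` to `y`, a walk from `x` can change sides only at `x`, where it may be
  -- restarted as the trivial walk.
  have key : ∀ v, G.Reach F x v → (v ∈ V₁ → G.Reach (F ∩ E(G.induce V₁)) x v) ∧
      (v ∈ V₂ → G.Reach (F ∩ E(G.induce V₂)) x v) := by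
    intro v hv
    induction hv with
    | refl => exact ⟨fun _ => Reach.refl .., fun _ => Reach.refl ..⟩
    | @tail v w _ hvw ih =>
      obtain ⟨e, he, hl⟩ := hvw
      rcases h.mem_or_mem hl with ⟨hv, hw⟩ | ⟨hv, hw⟩
      · have : G.Reach (F ∩ E(G.induce V₁)) x w :=
          (ih.1 hv).trans (hl.reach ⟨he, hl.mem_edgeSet_induce_iff.2 ⟨hv, hw⟩⟩)
        refine ⟨fun _ => this, fun hw' => ?_⟩
        rcases h.eq_or_eq hw hw' with rfl | rfl
        · exact Reach.refl ..
        · exact absurd this hn1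
      · have : G.Reach (F ∩ E(G.induce V₂)) x w :=
          (ih.2 hv).trans (hl.reach ⟨he, hl.mem_edgeSet_induce_iff.2 ⟨hv, hw⟩⟩)
        refine ⟨fun hw' => ?_, fun _ => this⟩
        rcases h.eq_or_eq hw' hw with rfl | rfl
        · exact Reach.refl ..
        · exact absurd this hn2
  exact hn1 ((key y hr).1 h.mem_left.2)

lemma isSpanningTree_left (h : G.IsTwoSeparation x y V₁ V₂) (hS : G.IsSpanningTree S)
    (hxy : G.Reach (S ∩ E(G.induce V₁)) x y) :
    (G.induce V₁).IsSpanningTree (S ∩ E(G.induce V₁)) := by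
  obtain ⟨-, -, hSc, hSa⟩ := isSpanningTree_iff.1 hS
  have hle := G.induce_le h.subset_left
  refine isSpanningTree_iff.2 ⟨Set.inter_subset_right, ⟨x, h.mem_left.1⟩, ?_,
    (hSa.mono Set.inter_subset_left).of_le hle⟩
  have key : ∀ v ∈ V₁, G.Reach (S ∩ E(G.induce V₁)) v x := by
    intro v hv
    rcases h.reach_left_or (hSc v (h.subset_left hv) x (h.subset_left h.mem_left.1)) hv with h | h
    · exact h
    · exact h.trans hxy.symm
  exact fun u hu v hv =>
    (reach_iff_of_le hle Set.inter_subset_right).2 ((key u hu).trans (key v hv).symm)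

/-- In an atomic bispanning graph, the two trees do not both join `x` and `y` in the same side of
a separation. -/
lemma not_reach_left_of_atomic (h : G.IsTwoSeparation x y V₁ V₂) (hG : G.AtomicBispanning)
    (hxy : x ≠ y) (hV : V₁ ≠ V(G)) (hS : G.IsSpanningTree S) (hT : G.IsSpanningTree T)
    (hdisj : Disjoint S T) (hunion : S ∪ T = E(G))
    (hSxy : G.Reach (S ∩ E(G.induce V₁)) x y) : ¬ G.Reach (T ∩ E(G.induce V₁)) x y := by
  intro hTxy
  have hle := G.induce_le h.subset_left
  -- Both trees restrict to spanning trees of `G.induce V₁`, which is proper by `hV` and is not a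
  -- single vertex because it contains `x ≠ y`.
  refine hG.2 ⟨hG.1, G.induce V₁, hle, ⟨_, _, h.isSpanningTree_left hS hSxy,
    h.isSpanningTree_left hT hTxy, hdisj.mono Set.inter_subset_left Set.inter_subset_left, ?_⟩,
    fun heq => hV (congrArg vertexSet heq), ?_⟩
  · rw [← Set.union_inter_distrib_right, hunion]
    exact Set.inter_eq_right.2 hle.edgeSet_mono
  · rintro ⟨v, hv⟩
    have hv : V₁ = {v} := congrArg vertexSet hv
    have hx := h.mem_left.1
    have hy := h.mem_left.2
    rw [hv] at hx hy
    exact hxy (hx.trans hy.symm)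

lemma bispanning_addNewEdge_left (h : G.IsTwoSeparation x y V₁ V₂) (hS : G.IsSpanningTree S)
    (hT : G.IsSpanningTree T) (hdisj : Disjoint S T) (hunion : S ∪ T = E(G))
    (hSxy : G.Reach (S ∩ E(G.induce V₁)) x y) (hTxy : ¬ G.Reach (T ∩ E(G.induce V₁)) x y) :
    ((G.induce V₁).addNewEdge x y).Bispanning := by
  obtain ⟨-, -, hTc, hTa⟩ := isSpanningTree_iff.1 hT
  have hle := G.induce_le h.subset_left
  refine bispanning_addNewEdge h.mem_left.1 h.mem_left.2 (h.isSpanningTree_left hS hSxy)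
    (T := T ∩ E(G.induce V₁)) Set.inter_subset_right
    ((hTa.mono Set.inter_subset_left).of_le hle) ?_ ?_
    (hdisj.mono Set.inter_subset_left Set.inter_subset_left) ?_
  · intro v hv
    simp only [reach_iff_of_le hle Set.inter_subset_right]
    exact h.reach_left_or (hTc v (h.subset_left hv) x (h.subset_left h.mem_left.1)) hv
  · rwa [reach_iff_of_le hle Set.inter_subset_right]
  · rw [← Set.union_inter_distrib_right, hunion]
    exact Set.inter_eq_right.2 hle.edgeSet_mono

/-- An edge `xy` lies in both sides, so `S` would join `x` to `y` in both, while `T` joins them in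
at least one. -/
lemma not_mem_tree_of_isLink (h : G.IsTwoSeparation x y V₁ V₂) (hG : G.AtomicBispanning)
    (hxy : x ≠ y) (hV₁ : V₁ ≠ V(G)) (hV₂ : V₂ ≠ V(G)) (hS : G.IsSpanningTree S)
    (hT : G.IsSpanningTree T) (hdisj : Disjoint S T) (hunion : S ∪ T = E(G))
    (hl : G.IsLink e x y) : e ∉ S := by
  intro he
  have h1 : G.Reach (S ∩ E(G.induce V₁)) x y :=
    hl.reach ⟨he, hl.mem_edgeSet_induce_iff.2 h.mem_left⟩
  have h2 : G.Reach (S ∩ E(G.induce V₂)) x y :=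
    hl.reach ⟨he, hl.mem_edgeSet_induce_iff.2 h.symm.mem_left⟩
  have hTxy := (isSpanningTree_iff.1 hT).2.2.1 x hl.left_mem y hl.right_mem
  rcases h.reach_left_or_reach_right hTxy with h3 | h3
  · exact h.not_reach_left_of_atomic hG hxy hV₁ hS hT hdisj hunion h1 h3
  · exact h.symm.not_reach_left_of_atomic hG hxy hV₂ hS hT hdisj hunion h2 h3

lemma not_isLink (h : G.IsTwoSeparation x y V₁ V₂) (hG : G.AtomicBispanning)
    (hxy : x ≠ y) (hV₁ : V₁ ≠ V(G)) (hV₂ : V₂ ≠ V(G)) : ¬ ∃ e, G.IsLink e x y := by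
  rintro ⟨e, hl⟩
  obtain ⟨S, T, hS, hT, hdisj, hunion⟩ := hG.1
  rcases (hunion.symm ▸ hl.edge_mem : e ∈ S ∪ T) with he | he
  · exact h.not_mem_tree_of_isLink hG hxy hV₁ hV₂ hS hT hdisj hunion hl he
  · exact h.not_mem_tree_of_isLink hG hxy hV₁ hV₂ hT hS hdisj.symm
      (by rw [Set.union_comm, hunion]) hl he

/-- A common edge would have both ends in `{x, y}`. -/
lemma disjoint_edgeSet [G.Loopless] (h : G.IsTwoSeparation x y V₁ V₂)
    (hno : ¬ ∃ e, G.IsLink e x y) : Disjoint E(G.induce V₁) E(G.induce V₂) := by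
  rw [Set.disjoint_left]
  rintro e ⟨u, v, hl, hu, hv⟩ h2
  obtain ⟨hu', hv'⟩ := hl.mem_edgeSet_induce_iff.1 h2
  have hne : u ≠ v := hl.ne
  rcases h.eq_or_eq hu hu' with rfl | rfl <;> rcases h.eq_or_eq hv hv' with rfl | rfl
  · exact hne rfl
  · exact hno ⟨e, hl⟩
  · exact hno ⟨e, hl.symm⟩
  · exact hne rfl

/-- Atomicity on the left forces `T` to join `x` to `y` on the right, so the trees swap roles there.
-/
lemma bispanning_of_reach_left (h : G.IsTwoSeparation x y V₁ V₂)
    (hG : G.AtomicBispanning)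
    (hxy : x ≠ y) (hV₁ : V₁ ≠ V(G)) (hV₂ : V₂ ≠ V(G)) (hS : G.IsSpanningTree S)
    (hT : G.IsSpanningTree T) (hdisj : Disjoint S T) (hunion : S ∪ T = E(G))
    (hSxy : G.Reach (S ∩ E(G.induce V₁)) x y) :
    ((G.induce V₁).addNewEdge x y).Bispanning ∧ ((G.induce V₂).addNewEdge x y).Bispanning := by
  have hT1 := h.not_reach_left_of_atomic hG hxy hV₁ hS hT hdisj hunion hSxy
  have hTxy := (isSpanningTree_iff.1 hT).2.2.1 x (h.subset_left h.mem_left.1) y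
    (h.subset_left h.mem_left.2)
  have hT2 := (h.reach_left_or_reach_right hTxy).resolve_left hT1
  have hunion' : T ∪ S = E(G) := by rw [Set.union_comm, hunion]
  have hS2 := h.symm.not_reach_left_of_atomic hG hxy hV₂ hT hS hdisj.symm hunion' hT2
  exact ⟨h.bispanning_addNewEdge_left hS hT hdisj hunion hSxy hT1,
    h.symm.bispanning_addNewEdge_left hT hS hdisj.symm hunion' hT2 hS2⟩

lemma bispanning (h : G.IsTwoSeparation x y V₁ V₂)
    (hG : G.AtomicBispanning)
    (hxy : x ≠ y) (hV₁ : V₁ ≠ V(G)) (hV₂ : V₂ ≠ V(G)) :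
    ((G.induce V₁).addNewEdge x y).Bispanning ∧ ((G.induce V₂).addNewEdge x y).Bispanning := by
  obtain ⟨S, T, hS, hT, hdisj, hunion⟩ := hG.1
  have hSxy := (isSpanningTree_iff.1 hS).2.2.1 x (h.subset_left h.mem_left.1) y
    (h.subset_left h.mem_left.2)
  rcases h.reach_left_or_reach_right hSxy with h1 | h1
  · exact h.bispanning_of_reach_left hG hxy hV₁ hV₂ hS hT hdisj hunion h1
  · exact (h.symm.bispanning_of_reach_left hG hxy hV₂ hV₁ hS hT hdisj hunion h1).symm

end IsTwoSeparation


/-! ### From a vertex cut to a separation. -/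

/-- `G` has a component, so the cut leaves at least two; a connected graph is its own only
component. -/
lemma exists_not_reachable_of_isVertexCut (hG : G.Connected) (h : G.IsVertexCut X) :
    ∃ u ∈ V(G.deleteVerts X), ∃ v ∈ V(G.deleteVerts X),
      ¬ ReflTransGen (G.deleteVerts X).Adj u v := by
  have h1 : 1 ≤ G.comp := by
    rw [comp, Set.one_le_encard_iff_nonempty]
    exact ⟨G, ⟨le_rfl, hG⟩, fun _ h _ => h.1⟩
  have h2 : 1 < (G.deleteVerts X).comp := h1.trans_lt h.2
  obtain ⟨C, D, hC, hD, hCD⟩ := Set.one_lt_encard_iff.1 h2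
  rw [Set.mem_ofPred_eq] at hC hD
  by_contra! hn
  have hconn : (G.deleteVerts X).Connected :=
    ⟨hC.prop.2.1.mono hC.prop.1.vertexSet_mono, hn⟩
  exact hCD ((hC.eq_of_le ⟨le_rfl, hconn⟩ hC.prop.1).trans
    (hD.eq_of_le ⟨le_rfl, hconn⟩ hD.prop.1).symm)

/-- On `ℕ`, `sSup` is `0` for empty and for unbounded sets, so a nonzero value is attained. -/
lemma vertexConnected_vconn (h : G.vconn ≠ 0) : G.VertexConnected G.vconn := by
  have hne : {k : ℕ | G.VertexConnected k}.Nonempty := by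
    by_contra hn
    exact h (by rw [vconn, Set.not_nonempty_iff_eq_empty.1 hn, csSup_empty]; rfl)
  have hbdd : BddAbove {k : ℕ | G.VertexConnected k} := by
    by_contra hn
    exact h (Nat.sSup_of_not_bddAbove hn)
  exact Nat.sSup_mem hne hbdd

lemma exists_isTwoSeparation (hG : G.VertexConnected 2) (hcut : G.IsVertexCut {x, y}) :
    x ≠ y ∧ ∃ V₁ V₂, G.IsTwoSeparation x y V₁ V₂ ∧ V₁ ≠ V(G) ∧ V₂ ≠ V(G) := by
  obtain ⟨u, hu, v, hv, huv⟩ := exists_not_reachable_of_isVertexCut hG.1 hcut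
  refine ⟨?_, ?_⟩
  · rintro rfl
    -- If `x = y`, only one vertex is deleted, which leaves `G` connected.
    refine huv ((hG.2.2 _ hcut.1 ?_).2 u hu v hv)
    simp
  -- The component of `u` after the deletion. The sides are `A ∪ {x, y}`, which misses `v`, and
  -- `V(G) \ A`, which misses `u`.
  let A : Set α := {w | w ∈ V(G) \ {x, y} ∧ ReflTransGen (G.deleteVerts {x, y}).Adj u w}
  rw [vertexSet_deleteVerts] at hu hv
  have hstep : ∀ {e a b}, G.IsLink e a b → a ∈ A → b ∈ A ∪ {x, y} := by
    intro e a b hl ha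
    by_cases hb : b ∈ ({x, y} : Set α)
    · exact Or.inr hb
    · exact Or.inl ⟨⟨hl.right_mem, hb⟩, ha.2.tail ⟨e, (deleteVerts_isLink ..).2 ⟨hl, ha.1.2, hb⟩⟩⟩
  have hxyV : ({x, y} : Set α) ⊆ V(G) := hcut.1
  have hAV : A ⊆ V(G) := fun w hw => hw.1.1
  have hdisj : ∀ w ∈ ({x, y} : Set α), w ∉ A := fun w hw hw' => hw'.1.2 hw
  refine ⟨A ∪ {x, y}, V(G) \ A, ⟨?_, ?_, ?_⟩, fun h => ?_, fun h => ?_⟩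
  · ext w
    have h1 := @hAV w
    have h2 := @hxyV w
    simp only [Set.mem_union, Set.mem_sdiff]
    tauto
  · ext w
    exact ⟨fun ⟨h1, h2⟩ => h1.resolve_left h2.2, fun h => ⟨Or.inr h, hxyV h, hdisj w h⟩⟩
  · intro e a b hl
    by_cases ha : a ∈ A
    · exact Or.inl ⟨Or.inl ha, hstep hl ha⟩
    by_cases hb : b ∈ A
    · exact Or.inl ⟨hstep hl.symm hb, Or.inl hb⟩
    · exact Or.inr ⟨⟨hl.left_mem, ha⟩, ⟨hl.right_mem, hb⟩⟩
  · rcases (h ▸ hv.1 : v ∈ A ∪ {x, y}) with h | h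
    · exact huv h.2
    · exact hv.2 h
  · have huA : u ∈ V(G) \ A := by rw [h]; exact hu.1
    exact huA.2 ⟨hu, ReflTransGen.refl⟩

/-! ### Parallel edges -/

lemma banana_isSpanningTree_singleton {F : Set β} (huv : u ≠ v) (he : e ∈ F) :
    (banana u v F).IsSpanningTree {e} := by
  have hl : (banana u v F).IsLink e u v := by simp [he]
  have hr := hl.reach (Set.mem_singleton e)
  refine isSpanningTree_iff.2 ⟨by simpa using he, ⟨u, by simp⟩, ?_, ?_⟩
  · rintro a (rfl | rfl) b (rfl | rfl)
    exacts [Reach.refl .., hr, hr.symm, Reach.refl ..]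
  · refine acyclic_of_forall_not_reach ?_
    rintro _ rfl a b hab h
    rcases ReflTransGen.cases_head h with rfl | ⟨c, ⟨f, hf, -⟩, -⟩
    · rcases hab with ⟨-, ⟨h1, h2⟩ | ⟨h1, h2⟩⟩
      · exact huv (h1.symm.trans h2)
      · exact huv (h2.symm.trans h1)
    · exact hf.2 hf.1

/-- Two parallel edges form a bispanning subgraph on two vertices, one edge per tree. -/
lemma AtomicBispanning.simple (hG : G.AtomicBispanning) (hloop : G.Loopless)
    (hcard : 2 < V(G).encard) : G.Simple := by
  refine { toLoopless := hloop, eq_of_isLink := fun e f u v he hf => ?_ }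
  by_contra hef
  have huv : u ≠ v := he.ne
  refine hG.2 ⟨hG.1, banana u v {e, f}, ⟨?_, ?_⟩, ⟨{e}, {f},
    banana_isSpanningTree_singleton huv (by simp), banana_isSpanningTree_singleton huv (by simp),
    by simpa using hef, by simp only [Set.singleton_union, edgeSet_banana]⟩, ?_, ?_⟩
  · rintro w (rfl | rfl)
    exacts [he.left_mem, he.right_mem]
  · rintro g a b ⟨rfl | rfl, ⟨rfl, rfl⟩ | ⟨rfl, rfl⟩⟩
    exacts [he, he.symm, hf, hf.symm]
  · rintro rfl
    simp [Set.encard_pair huv] at hcard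
  · rintro ⟨w, hw⟩
    have hw : ({u, v} : Set α) = {w} := congrArg vertexSet hw
    have h1 : u ∈ ({w} : Set α) := hw ▸ Set.mem_insert ..
    have h2 : v ∈ ({w} : Set α) := hw ▸ by simp
    exact huv (h1.trans h2.symm)

/-! ### The clique sum -/

lemma isKClique_banana_addNewEdge (hxy : x ≠ y) :
    (H.addNewEdge x y).IsKClique 2 (banana x y {none}) := by
  refine ⟨⟨Set.subset_union_right, ?_⟩, { not_isLoopAt := ?_, eq_of_isLink := ?_ },
    Set.encard_pair hxy, ?_⟩
  · rintro e a b ⟨rfl, ⟨rfl, rfl⟩ | ⟨rfl, rfl⟩⟩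
    exacts [addNewEdge_isLink_none.2 rfl, addNewEdge_isLink_none.2 Sym2.eq_swap]
  · intro e v h
    exact hxy ((banana_isLoopAt.1 h).2.2)
  · rintro e f a b ⟨rfl, -⟩ ⟨rfl, -⟩
    rfl
  · rintro u (rfl | rfl) v (rfl | rfl) huv
    · exact absurd rfl huv
    · exact ⟨none, by simp⟩
    · exact ⟨none, by simp⟩
    · exact absurd rfl huv

/-- The pairs of copies of `x` and of `y` that are contracted in a clique sum at `{x, y}`. -/
def twinPairs (x y : α) : Set (Set (α ⊕ α)) :=
  {X | ∃ v ∈ ({x, y} : Set α), X = {Sum.inl v, Sum.inr v}}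

lemma contractVertex_twinPairs_of_mem {c : α ⊕ α} (hv : v ∈ ({x, y} : Set α))
    (hc : c = Sum.inl v ∨ c = Sum.inr v) :
    contractVertex (twinPairs x y) c = Sum.inr {Sum.inl v, Sum.inr v} := by
  have hmem : {Sum.inl v, Sum.inr v} ∈ twinPairs x y := ⟨v, hv, rfl⟩
  have huniq : {X ∈ twinPairs x y | c ∈ X} = {{Sum.inl v, Sum.inr v}} := by
    ext X
    constructor
    · rintro ⟨⟨w, -, rfl⟩, hX⟩
      have : w = v := by
        rcases hc with rfl | rfl <;> simpa [eq_comm] using hX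
      rw [this]; rfl
    · rintro rfl
      exact ⟨hmem, hc⟩
  rw [contractVertex, if_pos ⟨_, hmem, hc⟩, huniq, Set.sUnion_singleton]

lemma contractVertex_twinPairs_of_notMem {c : α ⊕ α} (hv : v ∉ ({x, y} : Set α))
    (hc : c = Sum.inl v ∨ c = Sum.inr v) :
    contractVertex (twinPairs x y) c = Sum.inl c := by
  rw [contractVertex, if_neg]
  rintro ⟨_, ⟨w, hw, rfl⟩, hX⟩
  have : w = v := by
    rcases hc with rfl | rfl <;> simpa [eq_comm] using hX
  exact hv (this ▸ hw)

lemma contractVertex_twinPairs_inl_eq_inr (hv : v ∈ ({x, y} : Set α)) :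
    contractVertex (twinPairs x y) (Sum.inl v) = contractVertex (twinPairs x y) (Sum.inr v) :=
  (contractVertex_twinPairs_of_mem hv (Or.inl rfl)).trans
    (contractVertex_twinPairs_of_mem hv (Or.inr rfl)).symm

/-- Contraction of the pairs `{inl v, inr v}` identifies only copies of the same vertex. -/
lemma elim_eq_of_contractVertex_eq {c d : α ⊕ α}
    (h : contractVertex (twinPairs x y) c = contractVertex (twinPairs x y) d) :
    Sum.elim id id c = Sum.elim id id d := by
  have hc : ∀ c : α ⊕ α, c = Sum.inl (Sum.elim id id c) ∨ c = Sum.inr (Sum.elim id id c) := by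
    rintro (c | c) <;> simp
  by_cases h1 : Sum.elim id id c ∈ ({x, y} : Set α) <;>
    by_cases h2 : Sum.elim id id d ∈ ({x, y} : Set α)
  · rw [contractVertex_twinPairs_of_mem h1 (hc c), contractVertex_twinPairs_of_mem h2 (hc d),
      Sum.inr.injEq] at h
    have : (Sum.inl (Sum.elim id id c) : α ⊕ α) ∈
        ({Sum.inl (Sum.elim id id d), Sum.inr (Sum.elim id id d)} : Set (α ⊕ α)) :=
      h ▸ Set.mem_insert ..
    simpa using this
  · rw [contractVertex_twinPairs_of_mem h1 (hc c), contractVertex_twinPairs_of_notMem h2 (hc d)] at h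
    cases h
  · rw [contractVertex_twinPairs_of_notMem h1 (hc c), contractVertex_twinPairs_of_mem h2 (hc d)] at h
    cases h
  · rw [contractVertex_twinPairs_of_notMem h1 (hc c), contractVertex_twinPairs_of_notMem h2 (hc d),
      Sum.inl.injEq] at h
    rw [h]


lemma setOf_twins_eq_twinPairs (x y : α) (F : Set β) :
    {X : Set (α ⊕ α) | ∃ v : V(banana x y F), X = {Sum.inl (v : α),
      Sum.inr ((Equiv.refl V(banana x y F) v : V(banana x y F)) : α)}} = twinPairs x y := by
  ext X
  exact ⟨fun ⟨v, hv⟩ => ⟨v, v.2, hv⟩, fun ⟨v, hv, hX⟩ => ⟨⟨v, hv⟩, hX⟩⟩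

/-- The clique sum of `H₁ + {x, y}` and `H₂ + {x, y}` at the new edges, which are deleted. -/
noncomputable abbrev twoSum (H₁ H₂ : Graph α β) (x y : α) :
    Graph ((α ⊕ α) ⊕ Set (α ⊕ α)) (Option β ⊕ Option β) :=
  cliqueSum (H₁.addNewEdge x y) (H₂.addNewEdge x y) (banana x y {none}) (banana x y {none})
    (Equiv.refl _) ∅

lemma vertexSet_twoSum :
    V(twoSum H₁ H₂ x y) = contractVertex (twinPairs x y) ''
      (Sum.inl '' V(H₁.addNewEdge x y) ∪ Sum.inr '' V(H₂.addNewEdge x y)) := by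
  rw [twoSum, cliqueSum, setOf_twins_eq_twinPairs]
  rfl

/-- The new edges are deleted with the cliques. Contraction loses no old edge: each pair has one
vertex from each copy, so an edge inside a pair would be a loop. -/
lemma twoSum_isLink (h₁ : H₁.Loopless) (h₂ : H₂.Loopless) {e : Option β ⊕ Option β}
    {p q : (α ⊕ α) ⊕ Set (α ⊕ α)} :
    (twoSum H₁ H₂ x y).IsLink e p q ↔
      (∃ f a b, e = Sum.inl (some f) ∧ contractVertex (twinPairs x y) (Sum.inl a) = p ∧
        contractVertex (twinPairs x y) (Sum.inl b) = q ∧ H₁.IsLink f a b) ∨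
      (∃ f a b, e = Sum.inr (some f) ∧ contractVertex (twinPairs x y) (Sum.inr a) = p ∧
        contractVertex (twinPairs x y) (Sum.inr b) = q ∧ H₂.IsLink f a b) := by
  rw [twoSum, cliqueSum, setOf_twins_eq_twinPairs, deleteEdges_isLink, contract,
    deleteEdges_isLink, map_isLink]
  constructor
  · rintro ⟨⟨⟨_, _, ⟨f, a, b, rfl, rfl, rfl, h⟩ | ⟨f, a, b, rfl, rfl, rfl, h⟩, rfl, rfl⟩, -⟩, hn⟩
    all_goals
      rcases f with _ | f
      · exact absurd (by simp) hn
    · exact Or.inl ⟨f, a, b, rfl, rfl, rfl, addNewEdge_isLink_some.1 h⟩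
    · exact Or.inr ⟨f, a, b, rfl, rfl, rfl, addNewEdge_isLink_some.1 h⟩
  · rintro (⟨f, a, b, rfl, rfl, rfl, h⟩ | ⟨f, a, b, rfl, rfl, rfl, h⟩)
    · have hl : ((H₁.addNewEdge x y).disjointUnion (H₂.addNewEdge x y)).IsLink
          (Sum.inl (some f)) (Sum.inl a) (Sum.inl b) :=
        Or.inl ⟨_, _, _, rfl, rfl, rfl, addNewEdge_isLink_some.2 h⟩
      refine ⟨⟨⟨_, _, hl, rfl, rfl⟩, ?_⟩, by simp⟩
      rintro ⟨_, ⟨v, -, rfl⟩, hX⟩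
      have h1 := hX _ hl.inc_left
      have h2 := hX _ hl.inc_right
      simp only [Set.mem_insert_iff, Set.mem_singleton_iff, Sum.inl.injEq, reduceCtorEq,
        or_false] at h1 h2
      exact h.ne (h1.trans h2.symm)
    · have hl : ((H₁.addNewEdge x y).disjointUnion (H₂.addNewEdge x y)).IsLink
          (Sum.inr (some f)) (Sum.inr a) (Sum.inr b) :=
        Or.inr ⟨_, _, _, rfl, rfl, rfl, addNewEdge_isLink_some.2 h⟩
      refine ⟨⟨⟨_, _, hl, rfl, rfl⟩, ?_⟩, by simp⟩
      rintro ⟨_, ⟨v, -, rfl⟩, hX⟩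
      have h1 := hX _ hl.inc_left
      have h2 := hX _ hl.inc_right
      simp only [Set.mem_insert_iff, Set.mem_singleton_iff, Sum.inr.injEq, reduceCtorEq,
        false_or] at h1 h2
      exact h.ne (h1.trans h2.symm)

lemma edgeSet_twoSum (h₁ : H₁.Loopless) (h₂ : H₂.Loopless) :
    E(twoSum H₁ H₂ x y) =
      (fun e => Sum.inl (some e)) '' E(H₁) ∪ (fun e => Sum.inr (some e)) '' E(H₂) := by
  ext e
  rw [edge_mem_iff_exists_isLink]
  simp only [twoSum_isLink h₁ h₂]
  constructor
  · rintro ⟨p, q, ⟨f, a, b, rfl, -, -, h⟩ | ⟨f, a, b, rfl, -, -, h⟩⟩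
    exacts [Or.inl ⟨f, h.edge_mem, rfl⟩, Or.inr ⟨f, h.edge_mem, rfl⟩]
  · rintro (⟨f, hf, rfl⟩ | ⟨f, hf, rfl⟩)
    all_goals obtain ⟨a, b, h⟩ := exists_isLink_of_mem_edgeSet hf
    exacts [⟨_, _, Or.inl ⟨f, a, b, rfl, rfl, rfl, h⟩⟩, ⟨_, _, Or.inr ⟨f, a, b, rfl, rfl, rfl, h⟩⟩]

-- Each vertex goes to the class of its copy and each edge to its copy in the one side containing
-- it.
open Classical in
lemma IsTwoSeparation.nonempty_iso_twoSum (hloop : G.Loopless)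
    (h : G.IsTwoSeparation x y V₁ V₂) (hno : ¬ ∃ e, G.IsLink e x y) :
    Nonempty (G.Iso (twoSum (G.induce V₁) (G.induce V₂) x y)) := by
  have hdisj := h.disjoint_edgeSet hno
  have hl₁ : (G.induce V₁).Loopless := Loopless.anti (G.induce_le h.subset_left)
  have hl₂ : (G.induce V₂).Loopless := Loopless.anti (G.induce_le h.symm.subset_left)
  have hV₁ : V((G.induce V₁).addNewEdge x y) = V₁ :=
    vertexSet_addNewEdge h.mem_left.1 h.mem_left.2
  have hV₂ : V((G.induce V₂).addNewEdge x y) = V₂ :=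
    vertexSet_addNewEdge h.symm.mem_left.1 h.symm.mem_left.2
  let c : α ⊕ α → (α ⊕ α) ⊕ Set (α ⊕ α) := contractVertex (twinPairs x y)
  -- Preferring the left copy is harmless: the two copies of `x`, and of `y`, are identified.
  let φ : α → (α ⊕ α) ⊕ Set (α ⊕ α) := fun v => c (if v ∈ V₁ then Sum.inl v else Sum.inr v)
  let ψ : β → Option β ⊕ Option β := fun e =>
    if e ∈ E(G.induce V₁) then Sum.inl (some e) else Sum.inr (some e)
  have hφ₁ : ∀ v ∈ V₁, φ v = c (Sum.inl v) := fun v hv => by simp only [φ, if_pos hv]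
  have hφ₂ : ∀ v ∈ V₂, φ v = c (Sum.inr v) := by
    intro v hv
    by_cases hv' : v ∈ V₁
    · rw [hφ₁ v hv']
      exact contractVertex_twinPairs_inl_eq_inr (h.eq_or_eq hv' hv)
    · simp only [φ, if_neg hv']
  -- Forgetting the side recovers the vertex from any representative of its class; this gives
  -- injectivity and recovers the ends of edges.
  have hφ : ∀ v d, c d = φ v → Sum.elim id id d = v := by
    intro v d hd
    rw [elim_eq_of_contractVertex_eq hd]
    split_ifs <;> rfl
  have hψ₁ : ∀ e ∈ E(G.induce V₁), ψ e = Sum.inl (some e) := fun e he => if_pos he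
  have hψ₂ : ∀ e ∈ E(G.induce V₂), ψ e = Sum.inr (some e) :=
    fun e he => if_neg (Set.disjoint_right.1 hdisj he)
  have hVbij : Set.BijOn φ V(G) V(twoSum (G.induce V₁) (G.induce V₂) x y) := by
    rw [vertexSet_twoSum, hV₁, hV₂, ← h.union_eq]
    refine ⟨?_, ?_, ?_⟩
    · rintro v (hv | hv)
      · exact ⟨_, Or.inl ⟨v, hv, rfl⟩, (hφ₁ v hv).symm⟩
      · exact ⟨_, Or.inr ⟨v, hv, rfl⟩, (hφ₂ v hv).symm⟩
    · intro u _ v _ huv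
      rw [← hφ v _ huv]
      split_ifs <;> rfl
    · rintro _ ⟨_, ⟨v, hv, rfl⟩ | ⟨v, hv, rfl⟩, rfl⟩
      · exact ⟨v, Or.inl hv, hφ₁ v hv⟩
      · exact ⟨v, Or.inr hv, hφ₂ v hv⟩
  have hEbij : Set.BijOn ψ E(G) E(twoSum (G.induce V₁) (G.induce V₂) x y) := by
    rw [edgeSet_twoSum hl₁ hl₂, h.edgeSet_eq]
    refine ⟨?_, ?_, ?_⟩
    · rintro e (he | he)
      · exact Or.inl ⟨e, he, (hψ₁ e he).symm⟩
      · exact Or.inr ⟨e, he, (hψ₂ e he).symm⟩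
    · intro e _ f _ hef
      by_cases he : e ∈ E(G.induce V₁) <;> by_cases hf : f ∈ E(G.induce V₁) <;>
        simpa [ψ, he, hf] using hef
    · rintro _ (⟨e, he, rfl⟩ | ⟨e, he, rfl⟩)
      · exact ⟨e, Or.inl he, hψ₁ e he⟩
      · exact ⟨e, Or.inr he, hψ₂ e he⟩
  refine ⟨⟨hVbij.equiv φ, hEbij.equiv ψ, ?_⟩⟩
  rintro ⟨e, he⟩ ⟨u, hu⟩ ⟨v, hv⟩
  change (twoSum (G.induce V₁) (G.induce V₂) x y).IsLink (ψ e) (φ u) (φ v) ↔ G.IsLink e u v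
  rw [twoSum_isLink hl₁ hl₂]
  constructor
  · rintro (⟨f, a, b, hf, ha, hb, hl⟩ | ⟨f, a, b, hf, ha, hb, hl⟩)
    · rw [hψ₁ f hl.edge_mem |>.symm] at hf
      rw [hEbij.injOn he hl.1.edge_mem hf, ← hφ u _ ha, ← hφ v _ hb]
      exact hl.1
    · rw [hψ₂ f hl.edge_mem |>.symm] at hf
      rw [hEbij.injOn he hl.1.edge_mem hf, ← hφ u _ ha, ← hφ v _ hb]
      exact hl.1
  · intro hl
    rcases h.mem_or_mem hl with ⟨hu, hv⟩ | ⟨hu, hv⟩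
    · exact Or.inl ⟨e, u, v, hψ₁ e (hl.mem_edgeSet_induce_iff.2 ⟨hu, hv⟩), (hφ₁ u hu).symm,
        (hφ₁ v hv).symm, hl, hu, hv⟩
    · exact Or.inr ⟨e, u, v, hψ₂ e (hl.mem_edgeSet_induce_iff.2 ⟨hu, hv⟩), (hφ₂ u hu).symm,
        (hφ₂ v hv).symm, hl, hu, hv⟩

end Graph

theorem mainTheorem4 {α β : Type*} (G : Graph α β) (hfinV : V(G).Finite) (hfinE : E(G).Finite)
    (hloop : G.Loopless) (hG : G.AtomicBispanning) (hconn : G.vconn = 2)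
    (x y : α) (hcut : G.IsVertexCut {x, y}) :
    (¬ ∃ e, G.IsLink e x y) ∧
    ∃ V₁ V₂ : Set α,
      V₁ ∪ V₂ = V(G) ∧ V₁ ∩ V₂ = {x, y} ∧ V₁ ≠ V(G) ∧ V₂ ≠ V(G) ∧
      E(G) = E(G.induce V₁) ∪ E(G.induce V₂) ∧
      ((G.induce V₁).addNewEdge x y).Simple ∧ ((G.induce V₁).addNewEdge x y).Bispanning ∧
      ((G.induce V₂).addNewEdge x y).Simple ∧ ((G.induce V₂).addNewEdge x y).Bispanning ∧
      Graph.IsCliqueSum 2 G ((G.induce V₁).addNewEdge x y) ((G.induce V₂).addNewEdge x y)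
        (Graph.banana x y {none}) (Graph.banana x y {none}) (Equiv.refl _) ∅ := by

  have hvc : G.VertexConnected 2 := hconn ▸ Graph.vertexConnected_vconn (by rw [hconn]; decide)
  obtain ⟨hxy, V₁, V₂, hsep, hV₁, hV₂⟩ := Graph.exists_isTwoSeparation hvc hcut
  have hno := hsep.not_isLink hG hxy hV₁ hV₂
  have hsimple := hG.simple hloop hvc.2.1
  have hside : ∀ {W : Set α}, W ⊆ V(G) → ((G.induce W).addNewEdge x y).Simple := fun hW =>
    Graph.Simple.addNewEdge (Graph.Simple.anti (G.induce_le hW)) hxy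
      fun ⟨e, he⟩ => hno ⟨e, he.1⟩
  obtain ⟨hB₁, hB₂⟩ := hsep.bispanning hG hxy hV₁ hV₂
  exact ⟨hno, V₁, V₂, hsep.union_eq, hsep.inter_eq, hV₁, hV₂, hsep.edgeSet_eq,
    hside hsep.subset_left, hB₁, hside hsep.symm.subset_left, hB₂,
    Graph.isKClique_banana_addNewEdge hxy, Graph.isKClique_banana_addNewEdge hxy,
    Set.empty_subset _, hsep.nonempty_iso_twoSum hloop hno⟩
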